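/- Let $1\le r\le k$ be integers, let $F$ be a finitely generated function field of transcendence degree one over a finite field $\mathbb{F}_q$, let $g$ be its genus, and let $P_\infty$ be a rational place of $F$ with normalized valuation $v_{P_\infty}$. Let $S$ be the set of rational places of $F$ other than $P_\infty$. Put $h=\lceil k/(q-1)\rceil$, $d_1=k-1+g$ and $d_2=h-1+g$. Let $f_1,\dots,f_k\in\mathcal{L}(d_1P_\infty)$ and $g_1,\dots,g_h\in\mathcal{L}(d_2P_\infty)$ be functions such that $$0\ge v_{P_\infty}(f_1)>\cdots>v_{P_\infty}(f_k)\ge -d_1,\qquad 0\ge v_{P_\infty}(g_1)>\cdots>v_{P_\infty}(g_h)\ge -d_2,$$ where $\mathcal{L}(D)$ denotes the Riemann–Roch space of a divisor $D$. For $j\in\{1,\dots,k\}$ let $\alpha(j)=\lfloor (j-1)/(q-1)\rfloor+1$ and $\beta(j)=(j-1)\bmod (q-1)$, and let $\gamma$ be a generator of $\mathbb{F}_q^\times$. Let $E$ be the $r\times k$ matrix over $F$ with entries $$E_{ij}=(\gamma^{\beta(j)}g_{\alpha(j)})^{i-1}f_j,$$ and for $P\in S$ let $E(P)=(E_{ij}(P))_{i,j}$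 be the matrix over $\mathbb{F}_q$ obtained by evaluating the entries of $E$ at $P$. Then for every $M\in\mathbb{F}_q^{k\times r}$ of full rank (that is, of rank $r$), the number of $P\in S$ such that the $r\times r$ matrix $E(P)M$ does not have full rank is finite and at most $$r\left(k-r+\frac{r-1}{2}\left\lceil\frac{k}{q-1}\right\rceil+\frac{r+1}{2}\,g\right).$$ -/

import Mathlib

namespace FunField

/-- `F` is a finitely generated field extension of `K` of transcendence degree one. -/
structure IsFunctionField (K F : Type*) [Field K] [Field F] [Algebra K F] : Prop where
  fg : (⊤ : IntermediateField K F).FG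
  trdeg_eq_one : Algebra.trdeg K F = 1

/-- A place of `F / K`: a normalized discrete valuation `F → ℤ ∪ {∞}` that is trivial on `K`. -/
@[ext]
structure Place (K F : Type*) [Field K] [Field F] [Algebra K F] where
  /-- The underlying valuation, written additively. -/
  v : AddValuation F (WithTop ℤ)
  trivial_on_constants : ∀ c : K, c ≠ 0 → v (algebraMap K F c) = 0
  normalized : ∀ n : ℤ, ∃ x : F, v x = n

section

variable {K F : Type*} [Field K] [Field F] [Algebra K F]

theorem Place.v_algebraMap_nonneg (P : Place K F) (c : K) : 0 ≤ P.v (algebraMap K F c) := by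
  by_cases hc : c = 0
  · simp [hc]
  · exact (P.trivial_on_constants c hc).ge

/-- The valuation ring `O_P = {x : v_P x ≥ 0}`. -/
def Place.O (P : Place K F) : ValuationSubring F where
  carrier := {x | 0 ≤ P.v x}
  mul_mem' {a b} ha hb := by
    simp only [Set.mem_ofPred_eq, AddValuation.map_mul] at *
    exact add_nonneg ha hb
  one_mem' := by simp
  add_mem' {a b} ha hb := P.v.map_le_add ha hb
  zero_mem' := by simp
  neg_mem' {a} ha := by simpa using ha
  mem_or_inv_mem' x := by
    by_cases hx : x = 0
    · left; simp [hx]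
    · have h : P.v x + P.v x⁻¹ = 0 := by
        rw [← AddValuation.map_mul, mul_inv_cancel₀ hx, AddValuation.map_one]
      by_contra hcon
      simp only [Set.mem_ofPred_eq, not_or, not_le] at hcon
      exact absurd h ((add_le_of_nonpos_right hcon.2.le).trans_lt hcon.1).ne

theorem Place.mem_O (P : Place K F) {x : F} : x ∈ P.O ↔ 0 ≤ P.v x := Iff.rfl

noncomputable instance Place.instAlgebraO (P : Place K F) : Algebra K P.O :=
  ((algebraMap K F).codRestrict P.O.toSubring P.v_algebraMap_nonneg).toAlgebra

/-- The residue field `κ_P = O_P / m_P`, a field extension of `K`. -/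
abbrev Place.residueField (P : Place K F) : Type _ := IsLocalRing.ResidueField P.O

/-- The degree `[κ_P : K]` of a place. -/
noncomputable def Place.degree (P : Place K F) : ℕ := Module.finrank K P.residueField

/-- A place is rational if its degree is one. -/
def Place.IsRational (P : Place K F) : Prop := P.degree = 1

theorem Place.IsRational.bijective {P : Place K F} (hP : P.IsRational) :
    Function.Bijective (algebraMap K P.residueField) := by
  refine ⟨(algebraMap K P.residueField).injective, fun y => ?_⟩
  obtain ⟨c, hc⟩ := (finrank_eq_one_iff_of_nonzero' (1 : P.residueField) one_ne_zero).1 hP y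
  exact ⟨c, by rw [Algebra.algebraMap_eq_smul_one, hc]⟩

variable (K F) in
/-- The type of rational places of `F / K`. -/
def RationalPlace : Type _ := {P : Place K F // P.IsRational}

/-- Evaluation `O_P → κ_P = K` at a rational place. -/
noncomputable def RationalPlace.evalHom (P : RationalPlace K F) : P.1.O →+* K :=
  ((RingEquiv.ofBijective _ P.2.bijective).symm : P.1.residueField →+* K).comp
    (IsLocalRing.residue P.1.O)

open Classical in
/-- The value `x(P)` of a function `x ∈ O_P` at a rational place `P`
(with the dummy value `0` for functions that have a pole at `P`). -/
noncomputable def RationalPlace.eval (P : RationalPlace K F) (x : F) : K :=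
  if h : x ∈ P.1.O then P.evalHom ⟨x, h⟩ else 0

variable (K F) in
/-- Divisors: finite formal integer combinations of places. -/
abbrev Divisor : Type _ := Place K F →₀ ℤ

/-- The degree of a divisor. -/
noncomputable def Divisor.degree (D : Divisor K F) : ℤ := D.sum fun P n => n * (P.degree : ℤ)

/-- The Riemann–Roch space `L(D)`: all `x` with `v_P x ≥ -D_P` at every place `P`
(this includes `x = 0`, since `v_P 0 = ∞`). -/
def riemannRochSpace (D : Divisor K F) : Submodule K F where
  carrier := {x | ∀ P : Place K F, ((-(D P) : ℤ) : WithTop ℤ) ≤ P.v x}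
  add_mem' {a b} ha hb P := P.v.map_le_add (ha P) (hb P)
  zero_mem' P := by simp
  smul_mem' c x hx P := by
    rw [Algebra.smul_def, AddValuation.map_mul]
    exact (hx P).trans (le_add_of_nonneg_left (P.v_algebraMap_nonneg c))

variable (K F) in
/-- The genus of a function field: the maximum of `deg D + 1 - ℓ(D)` over all divisors `D`
(this set of integers is bounded above by Riemann's theorem). -/
noncomputable def genus : ℤ :=
  sSup (Set.range fun D : Divisor K F => Divisor.degree D + 1 - (Module.finrank K (riemannRochSpace D) : ℤ))

/-- `f 0, …, f (n-1)` are elements of `L(d P)` with `0 ≥ v_P (f 0) > ⋯ > v_P (f (n-1)) ≥ -d`. -/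
structure HasDecreasingOrders (P : Place K F) (d : ℤ) {n : ℕ} (f : Fin n → F) : Prop where
  mem : ∀ j, f j ∈ riemannRochSpace (Finsupp.single P d)
  nonpos : ∀ j, P.v (f j) ≤ 0
  strictAnti : StrictAnti fun j => P.v (f j)
  ge : ∀ j, ((-d : ℤ) : WithTop ℤ) ≤ P.v (f j)

/-- `h = ⌈k / (q - 1)⌉`. -/
def blockCount (q k : ℕ) : ℕ := ⌈(k : ℚ) / ((q : ℚ) - 1)⌉₊

theorem div_lt_blockCount {q k j : ℕ} (hq : 1 < q) (hj : j < k) :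
    j / (q - 1) < blockCount q k := by
  have hq' : (1 : ℚ) < q := by exact_mod_cast hq
  rw [blockCount, Nat.lt_ceil]
  refine (Nat.cast_div_le (α := ℚ)).trans_lt ?_
  rw [Nat.cast_sub hq.le, Nat.cast_one]
  exact div_lt_div_of_pos_right (by exact_mod_cast hj) (by linarith)

/-- The column `j` uses the function `g_α` with `α(j) = ⌊j / (q - 1)⌋`; all indices start at `0`. -/
noncomputable def alpha [Finite K] {k : ℕ} (j : Fin k) : Fin (blockCount (Nat.card K) k) :=
  ⟨j / (Nat.card K - 1), div_lt_blockCount Finite.one_lt_card j.2⟩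

/-- The column `j` uses the exponent `β(j) = j mod (q - 1)` of `γ`; all indices start at `0`. -/
noncomputable def beta (K : Type*) {k : ℕ} (j : Fin k) : ℕ := j % (Nat.card K - 1)

/-- The `r × k` matrix with entries `(γ ^ β(j) * g_α(j)) ^ i * f_j`, where all indices start
at `0`. -/
noncomputable def fsMatrix [Finite K] (r k : ℕ) (γ : Kˣ) (f : Fin k → F)
    (g : Fin (blockCount (Nat.card K) k) → F) : Matrix (Fin r) (Fin k) F :=
  Matrix.of fun i j =>
    (algebraMap K F ((γ : K) ^ beta K j) * g (alpha (K := K) j)) ^ (i : ℕ) * f j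

theorem mem_O_of_mem_riemannRochSpace {P Q : Place K F} (hQ : Q ≠ P) {d : ℤ} {x : F}
    (hx : x ∈ riemannRochSpace (Finsupp.single P d)) : x ∈ Q.O := by
  have h := hx Q
  rw [Finsupp.single_eq_of_ne hQ] at h
  simpa [Place.mem_O] using h

/-- The entries of the matrix can be evaluated at every place other than `P`, so the dummy value
of `RationalPlace.eval` never occurs there. -/
theorem fsMatrix_mem_O [Finite K] {r k : ℕ} (γ : Kˣ) {P Q : Place K F} (hQ : Q ≠ P)
    {f : Fin k → F} {g : Fin (blockCount (Nat.card K) k) → F} {d₁ d₂ : ℤ}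
    (hf : HasDecreasingOrders P d₁ f) (hg : HasDecreasingOrders P d₂ g) (i : Fin r) (j : Fin k) :
    fsMatrix r k γ f g i j ∈ Q.O :=
  mul_mem (pow_mem (mul_mem (Q.v_algebraMap_nonneg _)
    (mem_O_of_mem_riemannRochSpace hQ (hg.mem _))) _) (mem_O_of_mem_riemannRochSpace hQ (hf.mem _))

/-- The matrix `E(P)` obtained by evaluating all entries of `E` at the rational place `P`. -/
noncomputable def evalMatrix {r k : ℕ} (P : RationalPlace K F) (E : Matrix (Fin r) (Fin k) F) :
    Matrix (Fin r) (Fin k) K :=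
  E.map P.eval

end

end FunField

namespace FunField

section

variable {K F : Type*} [Field K] [Field F] [Algebra K F]

/-! ### Valuations trivial on the constants -/

section Valuation

open Polynomial

variable {Γ₀ : Type*} [LinearOrderedCommGroupWithZero Γ₀] (v : Valuation F Γ₀)
  {t : F}

/-! Put D = det(E M). The entries of E are regular away from P_∞, and at a rational place P ≠ P_∞
the matrix E(P)M is singular exactly when D vanishes at P. It therefore suffices that D is nonzero
with a pole of bounded order at P_∞, and that such a function has no more zeros than the order of
that pole.

Pole order (`exists_v_det_fsMatrix_mul`): invertible column operations put M in echelon form with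
pivot rows J. Multilinear expansion turns det(E M) into a combination of Vandermonde determinants in
the nodes θ_j = γ^β(j) g_α(j), scaled by products of the f_j. The order of θ_j - θ_i depends only on
the later index (`Place.v_node_sub`), so the pivot term has strictly the smallest value and nothing
cancels. The pole order is at most r d₁ + r(r-1)(d₂-1)/2, which is the claimed bound.

Zeros (`IsFunctionField.card_zeros_le`): if x has many zeros, powers of x times functions separating
these zeros are linearly independent, and too numerous for L(N P_∞), whose dimension is at most N +
1. That dimension bound rests on the existence of poles of transcendental functions
(`IsFunctionField.exists_place_neg`), proved by making the values of a suitable valuation ring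
discrete. -/

theorem valuation_aeval_le_one (hv : ∀ c : K, c ≠ 0 → v (algebraMap K F c) = 1)
    (ht : v t ≤ 1) (p : K[X]) : v (aeval t p) ≤ 1 := by
  rw [aeval_eq_sum_range]
  refine v.map_sum_le fun i _ => ?_
  rw [Algebra.smul_def, map_mul, map_pow]
  refine mul_le_one' ?_ (pow_le_one' ht i)
  by_cases hc : p.coeff i = 0
  · simp [hc]
  · exact (hv _ hc).le

/-- The constant term has value 1 and dominates the remainder, a multiple of `t`. -/
theorem valuation_aeval_eq_one (hv : ∀ c : K, c ≠ 0 → v (algebraMap K F c) = 1)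
    (ht : v t < 1) {p : K[X]} (hp : p.coeff 0 ≠ 0) :
    v (aeval t p) = 1 := by
  have h : aeval t p = aeval t p.divX * t + algebraMap K F (p.coeff 0) := by
    conv_lhs => rw [← p.divX_mul_X_add]
    simp
  rw [h, v.map_add_eq_of_lt_right, hv _ hp]
  rw [hv _ hp, map_mul]
  exact (mul_le_of_le_one_left' (valuation_aeval_le_one v hv ht.le _)).trans_lt ht

theorem exists_valuation_aeval_eq_pow (hv : ∀ c : K, c ≠ 0 → v (algebraMap K F c) = 1)
    (ht : v t < 1) {p : K[X]} (hp : p ≠ 0) :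
    ∃ m : ℕ, v (aeval t p) = v t ^ m := by
  obtain ⟨q, hq, hX⟩ := exists_eq_pow_rootMultiplicity_mul_and_not_dvd p hp 0
  rw [C_0, sub_zero] at hq hX
  -- Only the factor `X ^ m` contributes: the cofactor has nonzero constant term.
  refine ⟨rootMultiplicity 0 p, ?_⟩
  conv_lhs => rw [hq]
  rw [map_mul, map_mul, map_pow, map_pow, aeval_X,
    valuation_aeval_eq_one v hv ht (fun h => hX (X_dvd_iff.2 h)), mul_one]

open IntermediateField in
theorem exists_valuation_eq_zpow (hv : ∀ c : K, c ≠ 0 → v (algebraMap K F c) = 1)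
    (ht : v t < 1) {x : F} (hx : x ∈ K⟮t⟯) (hx0 : x ≠ 0) (ht0 : t ≠ 0) :
    ∃ m : ℤ, v x = v t ^ m := by
  obtain ⟨p, q, rfl⟩ := (IntermediateField.mem_adjoin_simple_iff K x).1 hx
  have hp : p ≠ 0 := fun h => hx0 (by simp [h])
  have hq : q ≠ 0 := fun h => hx0 (by simp [h])
  obtain ⟨i, hi⟩ := exists_valuation_aeval_eq_pow v hv ht hp
  obtain ⟨j, hj⟩ := exists_valuation_aeval_eq_pow v hv ht hq
  exact ⟨i - j, by
    rw [map_div₀, hi, hj, zpow_sub₀ (v.ne_zero_iff.2 ht0), zpow_natCast, zpow_natCast]⟩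

/-- If a finite sum of field elements vanishes, two of its nonzero terms have the same value. -/
theorem exists_valuation_eq_of_sum_eq_zero {ι : Type*} {s : Finset ι} {a : ι → F}
    (hs : s.Nonempty) (ha : ∀ i ∈ s, a i ≠ 0) (h : ∑ i ∈ s, a i = 0) :
    ∃ i ∈ s, ∃ j ∈ s, i ≠ j ∧ v (a i) = v (a j) := by
  classical
  obtain ⟨i, hi, hmax⟩ := s.exists_max_image (fun i => v (a i)) hs
  by_contra! hne
  rw [← Finset.add_sum_erase s a hi] at h
  have hlt : v (∑ j ∈ s.erase i, a j) < v (a i) := by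
    refine v.map_sum_lt (by simpa using ha i hi) fun j hj => ?_
    obtain ⟨hji, hj⟩ := Finset.mem_erase.1 hj
    exact (hmax j hj).lt_of_ne (hne i hi j hj hji.symm).symm
  have := v.map_add_eq_of_lt_left hlt
  rw [h, map_zero] at this
  exact ha i hi (by simpa using this.symm)

open IntermediateField in
/-- A valuation of a finite extension of `K(t)` takes values commensurable with that of `t`. -/
theorem exists_valuation_pow_factorial (hv : ∀ c : K, c ≠ 0 → v (algebraMap K F c) = 1)
    (ht : v t < 1) [FiniteDimensional K⟮t⟯ F] {y : F}
    (hy : y ≠ 0) (ht0 : t ≠ 0) : ∃ m : ℤ, v y ^ (Module.finrank K⟮t⟯ F).factorial = v t ^ m := by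
  have hint : IsIntegral K⟮t⟯ y := .of_finite _ _
  set p := minpoly K⟮t⟯ y with hp
  have hsum : ∑ i ∈ p.support, algebraMap K⟮t⟯ F (p.coeff i) * y ^ i = 0 := by
    have := minpoly.aeval K⟮t⟯ y
    rwa [aeval_def, eval₂_eq_sum, Polynomial.sum_def] at this
  obtain ⟨i, hi, j, hj, hij, h⟩ := exists_valuation_eq_of_sum_eq_zero v
    (by simpa using minpoly.ne_zero hint) (fun i hi => mul_ne_zero
      (by simpa using hi) (pow_ne_zero i hy)) hsum
  wlog hlt : i < j generalizing i j
  · exact this j hj i hi hij.symm h.symm (lt_of_le_of_ne (not_lt.1 hlt) hij.symm)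
  have hval : ∀ i ∈ p.support, ∃ m : ℤ, v (algebraMap K⟮t⟯ F (p.coeff i)) = v t ^ m :=
    fun i hi => exists_valuation_eq_zpow v hv ht (p.coeff i).2 (by simpa using hi) ht0
  obtain ⟨a, ha⟩ := hval i hi
  obtain ⟨b, hb⟩ := hval j hj
  have hvt : v t ≠ 0 := by simpa using ht0
  have hvy : v y ≠ 0 := by simpa using hy
  rw [map_mul, map_mul, ha, hb, map_pow, map_pow] at h
  have hd : v y ^ (j - i) = v t ^ (a - b) := by
    rw [zpow_sub₀ hvt, eq_div_iff (zpow_ne_zero _ hvt), ← mul_left_inj' (pow_ne_zero i hvy), h,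
      mul_right_comm, ← pow_add, Nat.sub_add_cancel hlt.le, mul_comm]
  have hle : j - i ≤ Module.finrank K⟮t⟯ F :=
    (Nat.sub_le _ _).trans ((le_natDegree_of_mem_supp j hj).trans (minpoly.natDegree_le y))
  -- The exponent `j - i` depends on `y`; the factorial of the degree is a multiple of all of them.
  obtain ⟨c, hc⟩ := Nat.dvd_factorial (Nat.sub_pos_of_lt hlt) hle
  exact ⟨(a - b) * c, by rw [hc, pow_mul, hd, zpow_mul, zpow_natCast]⟩

/-- A valuation whose values are, up to bounded exponent, powers of a single value is equivalent
to a normalized `ℤ`-valued one. -/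
theorem exists_normalized_addValuation (ht0 : t ≠ 0) (ht1 : v t < 1) {N : ℕ} (hN : 0 < N)
    (h : ∀ y : F, y ≠ 0 → ∃ m : ℤ, v y ^ N = v t ^ m) :
    ∃ w : AddValuation F (WithTop ℤ), (∀ n : ℤ, ∃ x, w x = n) ∧ ∀ x, 0 ≤ w x ↔ v x ≤ 1 := by
  classical
  have hanti : StrictAnti fun m : ℤ => v t ^ m :=
    zpow_right_strictAnti₀ (zero_lt_iff.2 (v.ne_zero_iff.2 ht0)) ht1
  -- `φ` is a homomorphism from the nonzero elements to `ℤ`. Its image is `dℤ`, nonzero because `φ t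
  -- = N`, and `φ / d` is the normalized valuation.
  choose! φ hφ using h
  have hmul : ∀ x y, x ≠ 0 → y ≠ 0 → φ (x * y) = φ x + φ y := fun x y hx hy =>
    hanti.injective <| by
      rw [zpow_add₀ (v.ne_zero_iff.2 ht0), ← hφ x hx, ← hφ y hy, ← hφ _ (mul_ne_zero hx hy),
        map_mul, mul_pow]
  have hle : ∀ x y, x ≠ 0 → y ≠ 0 → (φ x ≤ φ y ↔ v y ≤ v x) := fun x y hx hy => by
    rw [← hanti.le_iff_ge, ← hφ x hx, ← hφ y hy]
    exact pow_le_pow_iff_left₀ zero_le zero_le hN.ne'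
  have hone : φ 1 = 0 := by simpa using hmul 1 1 one_ne_zero one_ne_zero
  have hinv : ∀ x, x ≠ 0 → φ x⁻¹ = - φ x := fun x hx => by
    have := hmul x x⁻¹ hx (inv_ne_zero hx)
    rw [mul_inv_cancel₀ hx, hone] at this
    linarith
  have htN : φ t = N := hanti.injective <| by
    rw [← hφ t ht0, zpow_natCast]
  let S : AddSubgroup ℤ :=
    { carrier := {n | ∃ y, y ≠ 0 ∧ φ y = n}
      add_mem' := by
        rintro _ _ ⟨x, hx, rfl⟩ ⟨y, hy, rfl⟩
        exact ⟨x * y, mul_ne_zero hx hy, hmul x y hx hy⟩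
      zero_mem' := ⟨1, one_ne_zero, hone⟩
      neg_mem' := by
        rintro _ ⟨x, hx, rfl⟩
        exact ⟨x⁻¹, inv_ne_zero hx, hinv x hx⟩ }
  obtain ⟨d, hdpos, hdS, hd⟩ : ∃ d : ℤ, 0 < d ∧ d ∈ S ∧ ∀ n ∈ S, d ∣ n := by
    obtain ⟨a, ha⟩ := Int.subgroup_cyclic S
    have hmem : ∀ n, n ∈ S ↔ a ∣ n := fun n => by
      rw [ha, ← AddSubgroup.zmultiples_eq_closure, Int.mem_zmultiples_iff]
    refine ⟨|a|, abs_pos.2 ?_, by simp [hmem], fun n hn => (abs_dvd a n).2 ((hmem n).1 hn)⟩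
    rintro rfl
    have := (hmem _).1 ⟨t, ht0, htN⟩
    simp only [zero_dvd_iff] at this
    omega
  have hdiv : ∀ y, y ≠ 0 → d * (φ y / d) = φ y := fun y hy =>
    Int.mul_ediv_cancel' (hd _ ⟨y, hy, rfl⟩)
  have hdivle : ∀ x y, x ≠ 0 → y ≠ 0 → (φ x / d ≤ φ y / d ↔ v y ≤ v x) := fun x y hx hy => by
    rw [← hle x y hx hy, ← mul_le_mul_iff_right₀ hdpos, hdiv x hx, hdiv y hy]
  let w₀ : F → WithTop ℤ := fun y => if y = 0 then ⊤ else ((φ y / d : ℤ) : WithTop ℤ)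
  have hw₀ : ∀ y, y ≠ 0 → w₀ y = ((φ y / d : ℤ) : WithTop ℤ) := fun y hy => if_neg hy
  have hw0 : w₀ 0 = ⊤ := if_pos rfl
  refine ⟨AddValuation.of w₀ hw0 (by simp [hw₀, hone]) ?_ ?_, ?_, ?_⟩
  · intro x y
    by_cases hx : x = 0
    · simp [hx]
    by_cases hy : y = 0
    · simp [hy]
    by_cases hxy : x + y = 0
    · simp [hxy, hw0]
    rw [hw₀ x hx, hw₀ y hy, hw₀ _ hxy, min_le_iff, WithTop.coe_le_coe, WithTop.coe_le_coe,
      hdivle _ _ hx hxy, hdivle _ _ hy hxy, ← le_max_iff]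
    exact v.map_add x y
  · intro x y
    by_cases hx : x = 0
    · simp [hx, hw0]
    by_cases hy : y = 0
    · simp [hy, hw0]
    rw [hw₀ x hx, hw₀ y hy, hw₀ _ (mul_ne_zero hx hy), hmul x y hx hy, ← WithTop.coe_add,
      Int.add_ediv_of_dvd_left (hd _ ⟨x, hx, rfl⟩)]
  · intro n
    obtain ⟨y, hy, hyd⟩ := hdS
    have hpow : ∀ n : ℤ, φ (y ^ n) = n * d := fun n => hanti.injective <| by
      rw [← hφ _ (zpow_ne_zero n hy), map_zpow₀, ← zpow_natCast, zpow_comm, zpow_natCast, hφ y hy,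
        hyd, ← zpow_mul, mul_comm]
    refine ⟨y ^ n, ?_⟩
    rw [AddValuation.of_apply, hw₀ _ (zpow_ne_zero n hy), hpow, Int.mul_ediv_cancel _ hdpos.ne']
  · intro x
    rw [AddValuation.of_apply]
    by_cases hx : x = 0
    · simp [hx, hw0]
    have := hdivle 1 x one_ne_zero hx
    rw [hone, Int.zero_ediv, map_one] at this
    rw [hw₀ x hx, ← this]
    exact_mod_cast Iff.rfl

end Valuation

/-! ### Existence of poles -/

-- In transcendence degree one, `t` alone is a transcendence basis, so F is algebraic and finitely
-- generated over K(t).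
open IntermediateField in
theorem IsFunctionField.finiteDimensional_adjoin (hF : IsFunctionField K F) {t : F}
    (ht : Transcendental K t) : FiniteDimensional K⟮t⟯ F := by
  have hb : IsTranscendenceBasis K (fun _ : Unit => t) :=
    ((algebraicIndependent_unique_type_iff (ι := Unit)).2
      ht).isTranscendenceBasis_of_lift_trdeg_le_of_finite (by simp [hF.trdeg_eq_one])
  have halg := hb.isAlgebraic_field
  rw [Set.range_const] at halg
  have := IntermediateField.fg_top_iff.1 hF.fg
  have : Algebra.EssFiniteType K⟮t⟯ F := .of_comp K _ _
  exact Algebra.finite_of_essFiniteType_of_isAlgebraic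

/-- Every transcendental function has a pole. -/
theorem IsFunctionField.exists_place_neg (hF : IsFunctionField K F) {w : F}
    (hw : Transcendental K w) : ∃ P : Place K F, P.v w < 0 := by
  have hw0 : w ≠ 0 := fun h => hw (h ▸ isAlgebraic_zero)
  -- As `w` is not integral over K, some valuation ring contains the integral closure of K but not
  -- `w`; there `w⁻¹` has value less than 1.
  obtain ⟨V, hKV, hwV⟩ := Subring.exists_le_valuationSubring_of_isIntegrallyClosedIn
    (R := (integralClosure K F).toSubring) (x := w)
    (fun h => hw (show IsIntegral K w from h).isAlgebraic)
  replace hKV : ∀ c : K, algebraMap K F c ∈ V := fun c =>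
    hKV (show IsIntegral K _ from isIntegral_algebraMap)
  have hV : ∀ c : K, c ≠ 0 → V.valuation (algebraMap K F c) = 1 := fun c hc => by
    refine le_antisymm ((V.valuation_le_one_iff _).2 (hKV c)) ?_
    have := (V.valuation_le_one_iff _).2 (hKV c⁻¹)
    rwa [map_inv₀, map_inv₀, inv_le_one₀ (zero_lt_iff.2 (by simpa using hc))] at this
  have ht : V.valuation w⁻¹ < 1 := by
    rw [← V.valuation_le_one_iff, not_le] at hwV
    rw [map_inv₀]
    exact inv_lt_one_of_one_lt₀ hwV
  have ht0 : w⁻¹ ≠ 0 := inv_ne_zero hw0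
  have := hF.finiteDimensional_adjoin (t := w⁻¹) (fun h => hw (by simpa using h.inv))
  obtain ⟨u, hu, huV⟩ := exists_normalized_addValuation V.valuation ht0 ht
    (Nat.factorial_pos _) (fun y hy => exists_valuation_pow_factorial V.valuation hV ht hy ht0)
  have hnn : ∀ c : K, 0 ≤ u (algebraMap K F c) := fun c =>
    (huV _).2 ((V.valuation_le_one_iff _).2 (hKV c))
  refine ⟨⟨u, fun c hc => le_antisymm ?_ (hnn c), hu⟩, ?_⟩
  · have h1 : u (algebraMap K F c) + u (algebraMap K F c⁻¹) = 0 := by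
      rw [← u.map_mul, ← map_mul, mul_inv_cancel₀ hc, map_one, u.map_one]
    rw [← h1]
    exact le_add_of_nonneg_right (hnn _)
  · rw [← not_le]
    exact fun h => hwV ((V.valuation_le_one_iff _).1 ((huV w).1 h))

end

end FunField

/-! ### Evaluation at rational places and dimension of L(d P) -/

namespace FunField

section

variable {K F : Type*} [Field K] [Field F] [Algebra K F]

open Polynomial in
theorem Place.v_aeval_nonneg (P : Place K F) {t : F} (ht : 0 ≤ P.v t) (p : K[X]) :
    0 ≤ P.v (aeval t p) :=
  valuation_aeval_le_one (AddValuation.toValuation P.v) P.trivial_on_constants ht p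

open Polynomial in
theorem Place.v_aeval_eq_zero (P : Place K F) {t : F} (ht : 0 < P.v t) {p : K[X]}
    (hp : p.coeff 0 ≠ 0) : P.v (aeval t p) = 0 :=
  valuation_aeval_eq_one (AddValuation.toValuation P.v) P.trivial_on_constants ht hp

theorem Place.exists_v_eq_coe (P : Place K F) {x : F} (hx : x ≠ 0) : ∃ n : ℤ, P.v x = n := by
  obtain ⟨n, hn⟩ := WithTop.ne_top_iff_exists.1 ((P.v.ne_top_iff).2 hx)
  exact ⟨n, hn.symm⟩

theorem Place.isUnit_iff (P : Place K F) (x : P.O) : IsUnit x ↔ P.v (x : F) = 0 := by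
  constructor
  · rintro ⟨u, rfl⟩
    have h : P.v ((u : P.O) : F) + P.v ((↑u⁻¹ : P.O) : F) = 0 := by
      rw [← P.v.map_mul, ← P.O.coe_mul, Units.mul_inv, P.O.coe_one, P.v.map_one]
    refine le_antisymm ?_ (P.mem_O.1 (u : P.O).2)
    rw [← h]
    exact le_add_of_nonneg_right (P.mem_O.1 (↑u⁻¹ : P.O).2)
  · intro h
    have hx : (x : F) ≠ 0 := fun h0 => by simp [h0] at h
    have hinv : (x : F)⁻¹ ∈ P.O := by
      have h1 : P.v (x : F) + P.v (x : F)⁻¹ = 0 := by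
        rw [← P.v.map_mul, mul_inv_cancel₀ hx, P.v.map_one]
      rw [h, zero_add] at h1
      exact P.mem_O.2 h1.ge
    exact IsUnit.of_mul_eq_one ⟨_, hinv⟩ (Subtype.ext (mul_inv_cancel₀ hx))

theorem RationalPlace.evalHom_eq_zero_iff (P : RationalPlace K F) (x : P.1.O) :
    P.evalHom x = 0 ↔ 0 < P.1.v (x : F) := by
  rw [evalHom, RingHom.comp_apply, RingHom.coe_coe, map_eq_zero_iff _ (RingEquiv.injective _),
    IsLocalRing.residue_eq_zero_iff, IsLocalRing.mem_maximalIdeal, mem_nonunits_iff, P.1.isUnit_iff,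
    lt_iff_le_and_ne]
  exact ⟨fun h => ⟨P.1.mem_O.1 x.2, Ne.symm h⟩, fun h => h.2.symm⟩

theorem RationalPlace.evalHom_algebraMap (P : RationalPlace K F) (c : K) :
    P.evalHom (algebraMap K P.1.O c) = c := by
  rw [evalHom, RingHom.comp_apply, RingHom.coe_coe, RingEquiv.symm_apply_eq]
  rfl

theorem RationalPlace.eval_of_mem (P : RationalPlace K F) {x : F} (hx : x ∈ P.1.O) :
    P.eval x = P.evalHom ⟨x, hx⟩ := dif_pos hx

theorem mem_riemannRochSpace_single {P : Place K F} {d : ℤ} {x : F} :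
    x ∈ riemannRochSpace (Finsupp.single P d) ↔
      (∀ Q, Q ≠ P → 0 ≤ Q.v x) ∧ ((-d : ℤ) : WithTop ℤ) ≤ P.v x := by
  constructor
  · exact fun h => ⟨fun Q hQ => mem_O_of_mem_riemannRochSpace hQ h, by simpa using h P⟩
  · rintro ⟨h1, h2⟩ Q
    by_cases hQ : Q = P
    · subst hQ
      simpa using h2
    · simpa [Finsupp.single_eq_of_ne hQ] using h1 Q hQ

/-- A nonzero polynomial in `x` has the same value as a power of `x`, so it cannot vanish. -/
theorem Place.transcendental_of_pos (P : Place K F) {x : F} (hx : x ≠ 0) (hP : 0 < P.v x) :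
    Transcendental K x := by
  rintro ⟨p, hp, hpx⟩
  obtain ⟨m, hm⟩ := exists_valuation_aeval_eq_pow (AddValuation.toValuation P.v)
    P.trivial_on_constants hP hp
  rw [hpx, map_zero] at hm
  exact pow_ne_zero m ((Valuation.ne_zero_iff _).2 hx) hm.symm

/-- A function without poles that vanishes somewhere is zero. -/
theorem IsFunctionField.eq_zero_of_no_pole (hF : IsFunctionField K F) {x : F}
    (hx : ∀ Q : Place K F, 0 ≤ Q.v x) (P : Place K F) (hP : 0 < P.v x) : x = 0 := by
  by_contra h0
  have ht : Transcendental K x := P.transcendental_of_pos h0 hP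
  obtain ⟨Q, hQ⟩ := hF.exists_place_neg ht
  exact (hx Q).not_gt hQ

theorem riemannRochSpace_single_neg_one (hF : IsFunctionField K F) (P : Place K F) :
    riemannRochSpace (Finsupp.single P (-1)) = ⊥ := by
  rw [eq_bot_iff]
  intro x hx
  rw [mem_riemannRochSpace_single, neg_neg] at hx
  have hpos : 0 < P.v x := lt_of_lt_of_le (by exact_mod_cast zero_lt_one) hx.2
  refine hF.eq_zero_of_no_pole (fun Q => ?_) P hpos
  by_cases hQ : Q = P
  · exact hQ ▸ hpos.le
  · exact hx.1 Q hQ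

/-- The leading coefficient of elements of `L(d P)` with respect to `t` with `v_P t = d`. -/
noncomputable def RationalPlace.leadingCoeff (P : RationalPlace K F) (d : ℤ) {t : F}
    (ht : P.1.v t = d) : riemannRochSpace (Finsupp.single P.1 d) →ₗ[K] K where
  toFun x := P.evalHom ⟨x * t, by
    rw [P.1.mem_O, P.1.v.map_mul, ht]
    refine le_trans (le_of_eq ?_) (add_le_add_left (mem_riemannRochSpace_single.1 x.2).2 _)
    rw [← WithTop.coe_add, neg_add_cancel, WithTop.coe_zero]⟩
  map_add' x y := by
    refine Eq.trans (congrArg P.evalHom ?_) (map_add P.evalHom _ _)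
    exact Subtype.ext (add_mul _ _ _)
  map_smul' c x := by
    rw [RingHom.id_apply, smul_eq_mul]
    conv_rhs => rw [← P.evalHom_algebraMap c]
    rw [← map_mul]
    congr 1
    exact Subtype.ext (by
      change (c • (x : F)) * t = algebraMap K F c * (x * t)
      rw [Algebra.smul_def, mul_assoc])

theorem RationalPlace.ker_leadingCoeff (P : RationalPlace K F) (d : ℤ) {t : F}
    (ht : P.1.v t = d) (x : riemannRochSpace (Finsupp.single P.1 d))
    (hx : P.leadingCoeff d ht x = 0) : (x : F) ∈ riemannRochSpace (Finsupp.single P.1 (d - 1)) := by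
  have h := (P.evalHom_eq_zero_iff _).1 hx
  rw [P.1.v.map_mul, ht] at h
  refine mem_riemannRochSpace_single.2 ⟨(mem_riemannRochSpace_single.1 x.2).1, ?_⟩
  by_cases hx0 : (x : F) = 0
  · simp [hx0]
  obtain ⟨n, hn⟩ := P.1.exists_v_eq_coe hx0
  rw [hn] at h ⊢
  norm_cast at h ⊢
  omega

/-- The leading coefficient at P maps L(N P) to K with kernel inside L((N - 1) P), so each step adds
at most one dimension. The shift by one lets the induction start at L(-P) = 0. -/
theorem RationalPlace.finrank_riemannRochSpace_single_le (hF : IsFunctionField K F)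
    (P : RationalPlace K F) (N : ℕ) :
    FiniteDimensional K (riemannRochSpace (Finsupp.single P.1 ((N : ℤ) - 1))) ∧
      Module.finrank K (riemannRochSpace (Finsupp.single P.1 ((N : ℤ) - 1))) ≤ N := by
  induction N with
  | zero =>
    have h := riemannRochSpace_single_neg_one hF P.1
    rw [Nat.cast_zero, zero_sub, h]
    exact ⟨inferInstance, by simp⟩
  | succ N ih =>
    rw [Nat.cast_succ, add_sub_cancel_right]
    obtain ⟨t, ht⟩ := P.1.normalized N
    obtain ⟨h1, h2⟩ := ih
    set φ := P.leadingCoeff N ht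
    let ι : LinearMap.ker φ →ₗ[K] riemannRochSpace (Finsupp.single P.1 ((N : ℤ) - 1)) :=
      ((Submodule.subtype _).comp (Submodule.subtype _)).codRestrict _
        fun x => P.ker_leadingCoeff N ht x.1 x.2
    have hι : Function.Injective ι := fun x y h =>
      by
      have h' : ((x : riemannRochSpace (Finsupp.single P.1 (N : ℤ))) : F) = y :=
        congrArg (fun z : riemannRochSpace (Finsupp.single P.1 ((N : ℤ) - 1)) => (z : F)) h
      exact Subtype.ext (Subtype.ext h')
    have hker : FiniteDimensional K (LinearMap.ker φ) := .of_injective ι hι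
    have hfin : FiniteDimensional K (riemannRochSpace (Finsupp.single P.1 (N : ℤ))) :=
      by
      have : Module.Finite K (riemannRochSpace (Finsupp.single P.1 (N : ℤ)) ⧸ LinearMap.ker φ) :=
        .equiv φ.quotKerEquivRange.symm
      exact .of_submodule_quotient (LinearMap.ker φ)
    refine ⟨hfin, ?_⟩
    have h3 := φ.finrank_range_add_finrank_ker
    have h4 := LinearMap.finrank_le_finrank_of_injective hι
    have h5 := (LinearMap.range φ).finrank_le
    rw [Module.finrank_self] at h5
    omega

end

end FunField

namespace FunField

section

variable {K F : Type*} [Field K] [Field F] [Algebra K F]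

/-! ### Weak approximation -/

/-- The absolute value `2 ^ (-v_P)` attached to a place. -/
noncomputable def Place.absVal (P : Place K F) : AbsoluteValue F ℝ :=
  open Classical in
  have hval : ∀ {x : F} {n : ℤ}, P.v x = n → (if x = 0 then (0 : ℝ) else
      2 ^ (-(P.v x).untopD 0)) = 2 ^ (-n) := fun {x n} hn => by
    have hx : x ≠ 0 := by
      rintro rfl
      simp at hn
    rw [if_neg hx, hn, WithTop.untopD_coe]
  { toFun := fun x => if x = 0 then 0 else 2 ^ (-(P.v x).untopD 0)
    map_mul' := fun x y => by
      by_cases hx : x = 0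
      · simp [hx]
      by_cases hy : y = 0
      · simp [hy]
      obtain ⟨m, hm⟩ := P.exists_v_eq_coe hx
      obtain ⟨n, hn⟩ := P.exists_v_eq_coe hy
      have hmn : P.v (x * y) = (m + n : ℤ) := by rw [P.v.map_mul, hm, hn, WithTop.coe_add]
      rw [hval hm, hval hn, hval hmn, ← zpow_add₀ two_ne_zero, neg_add]
    nonneg' := fun x => by
      split_ifs
      · exact le_rfl
      · positivity
    eq_zero' := fun x => by
      split_ifs with hx
      · simp [hx]
      · simp only [hx, iff_false]
        positivity
    add_le' := fun x y => by
      by_cases hx : x = 0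
      · subst hx
        rw [if_pos (rfl : (0 : F) = 0), zero_add, zero_add]
      by_cases hy : y = 0
      · subst hy
        rw [if_pos (rfl : (0 : F) = 0), add_zero, add_zero]
      by_cases hxy : x + y = 0
      · rw [if_pos hxy, if_neg hx, if_neg hy]
        positivity
      obtain ⟨m, hm⟩ := P.exists_v_eq_coe hx
      obtain ⟨n, hn⟩ := P.exists_v_eq_coe hy
      obtain ⟨l, hl⟩ := P.exists_v_eq_coe hxy
      rw [hval hm, hval hn, hval hl]
      have h := P.v.map_add x y
      rw [hm, hn, hl, min_le_iff, WithTop.coe_le_coe, WithTop.coe_le_coe] at h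
      rcases h with h | h
      · exact (zpow_le_zpow_right₀ one_le_two (neg_le_neg h)).trans
          (le_add_of_nonneg_right (by positivity))
      · exact (zpow_le_zpow_right₀ one_le_two (neg_le_neg h)).trans
          (le_add_of_nonneg_left (by positivity)) }

open Classical in
theorem Place.absVal_eq (P : Place K F) {x : F} {n : ℤ} (h : P.v x = n) :
    P.absVal x = 2 ^ (-n) := by
  have hx : x ≠ 0 := by
    rintro rfl
    simp at h
  change (if x = 0 then (0 : ℝ) else 2 ^ (-(P.v x).untopD 0)) = _
  rw [if_neg hx, h, WithTop.untopD_coe]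

theorem Place.absVal_le_iff (P : Place K F) {x y : F} :
    P.absVal x ≤ P.absVal y ↔ P.v y ≤ P.v x := by
  by_cases hx : x = 0
  · simp [hx]
  by_cases hy : y = 0
  · simp only [hy, map_zero, P.v.map_zero, top_le_iff, P.v.top_iff]
    exact ⟨fun h => P.absVal.eq_zero.1 (le_antisymm h (P.absVal.nonneg _)), fun h => by simp [h]⟩
  obtain ⟨m, hm⟩ := P.exists_v_eq_coe hx
  obtain ⟨n, hn⟩ := P.exists_v_eq_coe hy
  rw [P.absVal_eq hm, P.absVal_eq hn, hm, hn, WithTop.coe_le_coe,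
    zpow_le_zpow_iff_right₀ one_lt_two, neg_le_neg_iff]

/-- Equivalent absolute values order F in the same way. A uniformizer `t` of P, having the least
positive value, is then one of Q, and comparing `x` with powers of `t` identifies the two
valuations. -/
theorem Place.eq_of_isEquiv {P Q : Place K F} (h : P.absVal.IsEquiv Q.absVal) : P = Q := by
  have hle : ∀ x y, P.v y ≤ P.v x ↔ Q.v y ≤ Q.v x := fun x y => by
    rw [← P.absVal_le_iff, ← Q.absVal_le_iff]
    exact h x y
  have heq : ∀ x y, P.v x = P.v y → Q.v x = Q.v y := fun x y hxy =>
    le_antisymm ((hle y x).1 hxy.le) ((hle x y).1 hxy.ge)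
  have hlt : ∀ x y, P.v x < P.v y ↔ Q.v x < Q.v y := fun x y => by
    rw [← not_le, ← not_le, hle]
  obtain ⟨t, ht⟩ := P.normalized 1
  obtain ⟨s, hs⟩ := Q.normalized 1
  have hs0 : s ≠ 0 := by
    rintro rfl
    simp at hs
  have ht0 : t ≠ 0 := by
    rintro rfl
    simp at ht
  have hQt : Q.v t = 1 := by
    obtain ⟨m, hm⟩ := P.exists_v_eq_coe hs0
    obtain ⟨n, hn⟩ := Q.exists_v_eq_coe ht0
    have h1 := (hlt 1 t).1 (by rw [P.v.map_one, ht]; exact_mod_cast zero_lt_one)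
    have h2 := (hlt 1 s).2 (by rw [Q.v.map_one, hs]; exact_mod_cast zero_lt_one)
    have h3 := hle s t
    rw [P.v.map_one, hm] at h2
    rw [Q.v.map_one, hn] at h1
    rw [hm, ht, hs, hn] at h3
    rw [hn]
    norm_cast at *
    omega
  have hzpow : ∀ (R : Place K F) (n : ℤ), R.v t = 1 → R.v (t ^ n) = n := fun R n hR => by
    have hnat : ∀ n : ℕ, R.v (t ^ n) = (n : ℤ) := fun n => by
      rw [R.v.map_pow, hR]
      simp
    obtain ⟨k, rfl | rfl⟩ := n.eq_nat_or_neg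
    · rw [zpow_natCast, hnat]
    · rw [zpow_neg, zpow_natCast, R.v.map_inv, hnat]
      rfl
  refine Place.ext (AddValuation.ext fun x => ?_)
  by_cases hx : x = 0
  · simp [hx]
  obtain ⟨n, hn⟩ := P.exists_v_eq_coe hx
  rw [hn, heq x (t ^ n) (by rw [hn, hzpow P n (by simpa using ht)]), hzpow Q n hQt]

theorem Place.absVal_isNontrivial (P : Place K F) : P.absVal.IsNontrivial := by
  obtain ⟨t, ht⟩ := P.normalized 1
  refine ⟨t, ?_, ?_⟩
  · rintro rfl
    simp at ht
  · rw [P.absVal_eq ht]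
    norm_num

/-- Functions separating finitely many places. -/
theorem exists_separating {ι : Type*} [Finite ι] (P : ι → Place K F) (hP : Function.Injective P) :
    ∃ e : ι → F, ∀ i, (P i).v (e i) = 0 ∧ ∀ j, j ≠ i → 0 < (P j).v (e i) := by
  have h := AbsoluteValue.exists_one_lt_lt_one_pi_of_not_isEquiv
    (v := fun i => (P i).absVal) (fun i => (P i).absVal_isNontrivial)
    (fun i j hij hE => hij (hP (Place.eq_of_isEquiv hE)))
  choose a ha ha' using h
  have hneg : ∀ i, (P i).v (a i) < 0 := fun i => by
    rw [← not_le, ← (P i).v.map_one, ← (P i).absVal_le_iff, map_one, not_le]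
    exact ha i
  have hpos : ∀ i j, j ≠ i → 0 < (P j).v (a i) := fun i j hj => by
    rw [← not_le, ← (P j).v.map_one, ← (P j).absVal_le_iff, map_one, not_le]
    exact ha' i j hj
  -- `a i` has a pole at `P i` and zeros at the other places, so `1 + a i` has the order of `a i` at
  -- `P i` and order 0 elsewhere.
  refine ⟨fun i => a i / (1 + a i), fun i => ⟨?_, fun j hj => ?_⟩⟩
  · have h0 : a i ≠ 0 := fun h0 => by simpa [h0] using hneg i
    obtain ⟨n, hn⟩ := (P i).exists_v_eq_coe h0
    rw [AddValuation.map_div, (P i).v.map_add_eq_of_lt_right (by simpa using hneg i), hn]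
    norm_cast
    simp
  · rw [AddValuation.map_div, (P j).v.map_add_eq_of_lt_left (by simpa using hpos i j hj),
      (P j).v.map_one]
    simpa using hpos i j hj

end

end FunField

/-! ### Zeros are bounded by the pole order -/

namespace FunField

section

variable {K F : Type*} [Field K] [Field F] [Algebra K F]

open Polynomial

theorem IsFunctionField.isAlgebraic_adjoin (hF : IsFunctionField K F) {t : F}
    (ht : Transcendental K t) : Algebra.IsAlgebraic (Algebra.adjoin K {t}) F := by
  have := (hF.finiteDimensional_adjoin ht)
  exact IntermediateField.isAlgebraic_adjoin_iff_top.1 inferInstance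

/-- The valuation ring of P contains K[x] and is integrally closed. -/
theorem Place.v_nonneg_of_isIntegral (P : Place K F) {x y : F} (hx : 0 ≤ P.v x)
    (hy : IsIntegral (Algebra.adjoin K {x}) y) : 0 ≤ P.v y := by
  have hR : ∀ r : Algebra.adjoin K {x}, (r : F) ∈ P.O := by
    rintro ⟨r, hr⟩
    rw [Algebra.adjoin_singleton_eq_range_aeval] at hr
    obtain ⟨p, rfl⟩ := hr
    exact P.v_aeval_nonneg hx p
  let φ : Algebra.adjoin K {x} →+* P.O :=
    (algebraMap (Algebra.adjoin K {x}) F).codRestrict P.O.toSubring hR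
  obtain ⟨p, hp, hpy⟩ := hy
  have h : IsIntegral P.O y := ⟨p.map φ, hp.map φ, by rw [eval₂_map]; exact hpy⟩
  obtain ⟨z, rfl⟩ := (IsIntegrallyClosed.isIntegral_iff).1 h
  exact z.2

/-- Every function becomes regular at all places where `x` is, after multiplication by a nonzero
polynomial in `x`. -/
theorem IsFunctionField.exists_aeval_mul_regular (hF : IsFunctionField K F) {x : F}
    (hx : Transcendental K x) (y : F) :
    ∃ p : K[X], p ≠ 0 ∧ ∀ P : Place K F, 0 ≤ P.v x → 0 ≤ P.v (aeval x p * y) := by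
  have := hF.isAlgebraic_adjoin hx
  obtain ⟨r, hr, hri⟩ := (Algebra.IsAlgebraic.isAlgebraic
    (R := Algebra.adjoin K {x}) y).exists_integral_multiple
  obtain ⟨p, hp⟩ : ∃ p : K[X], aeval x p = (r : F) := by
    exact (Algebra.adjoin_singleton_eq_range_aeval K x).le r.2
  refine ⟨p, ?_, fun P hP => P.v_nonneg_of_isIntegral hP ?_⟩
  · rintro rfl
    exact hr (Subtype.ext (by simpa using hp.symm))
  · rw [hp]
    exact hri

/-- Functions separating common zeros of `x` are linearly independent over `K[x]`. -/
theorem eq_zero_of_sum_aeval_mul_eq_zero {ι : Type*} [Fintype ι] {P : ι → Place K F} {e : ι → F}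
    (he : ∀ i, (P i).v (e i) = 0 ∧ ∀ j, j ≠ i → 0 < (P j).v (e i)) {x : F} (hx0 : x ≠ 0)
    (hx : ∀ i, 0 < (P i).v x) {p : ι → K[X]} (hp : ∑ i, aeval x (p i) * e i = 0) (i : ι) :
    p i = 0 := by
  classical
  -- At `P i` the i-th term would have value 0 and all others positive value. Once all constant
  -- terms vanish, a factor `x` cancels, so every power of `X` divides each `p i`.
  have hX : ∀ p : ι → K[X], ∑ i, aeval x (p i) * e i = 0 → ∀ i, (p i).coeff 0 = 0 := by
    intro p hp i
    by_contra hi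
    rw [← Finset.add_sum_erase _ _ (Finset.mem_univ i)] at hp
    have h1 : (P i).v (aeval x (p i) * e i) = 0 := by
      rw [AddValuation.map_mul, (P i).v_aeval_eq_zero (hx i) hi, (he i).1, add_zero]
    have h2 : 0 < (P i).v (∑ j ∈ Finset.univ.erase i, aeval x (p j) * e j) := by
      refine AddValuation.map_lt_sum _ WithTop.zero_ne_top fun j hj => ?_
      rw [AddValuation.map_mul]
      exact ((he j).2 i (Finset.ne_of_mem_erase hj).symm).trans_le
        (le_add_of_nonneg_left ((P i).v_aeval_nonneg (hx i).le _))
    have h3 := (P i).v.map_add_eq_of_lt_left (h1.trans_lt h2)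
    rw [hp, h1, AddValuation.map_zero] at h3
    exact WithTop.zero_ne_top h3.symm
  have hpow : ∀ (m : ℕ) (p : ι → K[X]), ∑ i, aeval x (p i) * e i = 0 → ∀ i, X ^ m ∣ p i := by
    intro m
    induction m with
    | zero => simp
    | succ m ih =>
      intro p hp i
      have hdiv : ∀ i, p i = X * (p i).divX := fun i => by
        conv_lhs => rw [← (p i).X_mul_divX_add]
        rw [hX p hp i, C_0, add_zero]
      have h : ∑ i, aeval x ((p i).divX) * e i = 0 := by
        refine (mul_eq_zero.1 ?_).resolve_left hx0
        rw [Finset.mul_sum, ← hp]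
        refine Finset.sum_congr rfl fun j _ => ?_
        conv_rhs => rw [hdiv j]
        rw [map_mul, aeval_X, mul_assoc]
      rw [hdiv i, pow_succ']
      exact mul_dvd_mul_left X (ih _ h i)
  by_contra hi
  have := natDegree_le_of_dvd (hpow ((p i).natDegree + 1) p hp i) hi
  rw [natDegree_X_pow] at this
  omega

/-- A function whose only pole is a rational place has at most as many zeros as the order of this
pole. -/
theorem IsFunctionField.card_zeros_le (hF : IsFunctionField K F) (Q : RationalPlace K F) {x : F}
    (hx0 : x ≠ 0) (hx : ∀ P : Place K F, P ≠ Q.1 → 0 ≤ P.v x) {n : ℕ}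
    (hn : ((-n : ℤ) : WithTop ℤ) ≤ Q.1.v x) (s : Finset (Place K F))
    (hs : ∀ P ∈ s, 0 < P.v x) : s.card ≤ n := by
  classical
  obtain rfl | ⟨P₀, hP₀⟩ := s.eq_empty_or_nonempty
  · simp
  have ht := P₀.transcendental_of_pos hx0 (hs P₀ hP₀)
  obtain ⟨e, he⟩ := exists_separating (fun P : s => P.1) Subtype.val_injective
  choose y hy0 hy using fun P : s => hF.exists_aeval_mul_regular ht (e P)
  have hb0 : ∀ P, aeval x (y P) * e P ≠ 0 := fun P h => by
    rcases mul_eq_zero.1 h with h | h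
    · exact hy0 P ((transcendental_iff.1 ht) _ h)
    · have := (he P).1
      simp [h] at this
  choose c hc using fun P : s => Q.1.exists_v_eq_coe (hb0 P)
  -- `C` bounds the pole orders at Q of the regularized separating functions. With exponents up to
  -- `C + 1` of `x`, all products have pole order at most `N`.
  set C : ℕ := ∑ P : s, (c P).natAbs with hC
  have hcC : ∀ P, -(C : ℤ) ≤ c P := fun P => by
    have := Finset.single_le_sum (f := fun P : s => (c P).natAbs) (fun _ _ => Nat.zero_le _)
      (Finset.mem_univ P)
    omega
  set N : ℕ := n * (C + 1) + C with hN
  have hmem : ∀ i : s × Fin (C + 2), x ^ (i.2 : ℕ) * (aeval x (y i.1) * e i.1) ∈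
      riemannRochSpace (Finsupp.single Q.1 (((N + 1 : ℕ) : ℤ) - 1)) := by
    rintro ⟨P, a⟩
    refine mem_riemannRochSpace_single.2 ⟨fun R hR => ?_, ?_⟩
    · rw [AddValuation.map_mul, AddValuation.map_pow]
      exact add_nonneg (nsmul_nonneg (hx R hR) _) (hy P R (hx R hR))
    · obtain ⟨m, hm⟩ := Q.1.exists_v_eq_coe hx0
      rw [AddValuation.map_mul, AddValuation.map_pow, hc P, hm]
      rw [hm] at hn
      have h0 : ((N + 1 : ℕ) : ℤ) - 1 = n * (C + 1) + C := by
        rw [hN]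
        push_cast
        ring
      rw [h0]
      norm_cast at hn ⊢
      have h1 := hcC P
      have h2 : (a : ℕ) ≤ C + 1 := by omega
      have h3 : (a : ℤ) * (-n) ≤ a * m := mul_le_mul_of_nonneg_left hn (by positivity)
      have h4 : (a : ℤ) * n ≤ (C + 1) * n :=
        mul_le_mul_of_nonneg_right (by exact_mod_cast h2) (by positivity)
      rw [nsmul_eq_mul]
      push_cast
      linarith
  let z : s × Fin (C + 2) → riemannRochSpace (Finsupp.single Q.1 (((N + 1 : ℕ) : ℤ) - 1)) :=
    fun i => ⟨_, hmem i⟩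
  have hz : LinearIndependent K z := by
    rw [Fintype.linearIndependent_iff]
    intro l hl
    -- Grouping the relation by places gives a relation over K[x] between the separating functions.
    have h1 : ∑ P : s, aeval x ((∑ a : Fin (C + 2),
        Polynomial.C (l (P, a)) * X ^ (a : ℕ)) * y P) * e P = 0 := by
      have h := congrArg (Submodule.subtype _) hl
      rw [map_sum, map_zero, Fintype.sum_prod_type] at h
      rw [← h]
      refine Finset.sum_congr rfl fun P _ => ?_
      rw [map_mul, map_sum, mul_assoc, Finset.sum_mul]
      refine Finset.sum_congr rfl fun a _ => ?_
      rw [map_smul, map_mul, aeval_C, map_pow, aeval_X, mul_assoc, ← Algebra.smul_def]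
      rfl
    have h2 := eq_zero_of_sum_aeval_mul_eq_zero he hx0 (fun P => hs P.1 P.2) h1
    rintro ⟨P, a⟩
    have h3 := (mul_eq_zero.1 (h2 P)).resolve_right (hy0 P)
    have h4 := congrArg (fun p => p.coeff (a : ℕ)) h3
    simpa [finsetSum_coeff, coeff_X_pow, Fin.val_inj] using h4
  obtain ⟨hfin, hle⟩ := Q.finrank_riemannRochSpace_single_le hF (N + 1)
  have hcard := hz.fintype_card_le_finrank.trans hle
  rw [Fintype.card_prod, Fintype.card_coe, Fintype.card_fin] at hcard
  -- With `n + 1` zeros there would be at least `(n + 1)(C + 2)` independent functions in a space of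
  -- dimension at most `N + 1 = n(C + 1) + C + 1`.
  by_contra! hlt
  have : (n + 1) * (C + 2) ≤ s.card * (C + 2) := Nat.mul_le_mul_right _ hlt
  have h5 : (n + 1) * (C + 2) = n * (C + 1) + C + 1 + (n + 1) := by ring
  omega

end

end FunField

namespace FunField

/-! ### Column echelon form -/

section

variable {K : Type*} [Field K]

open Classical in
/-- One more than the last index at which `w` is nonzero. -/
noncomputable def topIndex {k : ℕ} (w : Fin k → K) : ℕ :=
  (Finset.univ.filter fun i => w i ≠ 0).sup fun i => (i : ℕ) + 1

theorem eq_zero_of_topIndex_le {k : ℕ} {w : Fin k → K} {i : Fin k} (h : topIndex w ≤ i) :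
    w i = 0 := by
  classical
  by_contra hi
  have : (i : ℕ) + 1 ≤ topIndex w :=
    Finset.le_sup (f := fun i : Fin k => (i : ℕ) + 1) (by simpa using hi)
  omega

theorem topIndex_le {k : ℕ} {w : Fin k → K} {m : ℕ} (h : ∀ i : Fin k, m ≤ i → w i = 0) :
    topIndex w ≤ m := by
  classical
  refine Finset.sup_le fun i hi => ?_
  by_contra hlt
  exact (Finset.mem_filter.1 hi).2 (h i (by omega))

theorem exists_topIndex_eq {k : ℕ} {w : Fin k → K} (hw : w ≠ 0) :
    ∃ i : Fin k, w i ≠ 0 ∧ topIndex w = i + 1 := by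
  classical
  obtain ⟨i, hi⟩ := Function.ne_iff.1 hw
  obtain ⟨j, hj, h⟩ := Finset.exists_mem_eq_sup (Finset.univ.filter fun i => w i ≠ 0)
    ⟨i, by simpa using hi⟩ fun i => (i : ℕ) + 1
  exact ⟨j, (Finset.mem_filter.1 hj).2, h⟩

/-- A matrix of full column rank can be brought into column echelon form. -/
theorem exists_echelon {r k : ℕ} (M : Matrix (Fin k) (Fin r) K) (hM : M.rank = r) :
    ∃ (N : Matrix (Fin r) (Fin r) K) (J : Fin r → Fin k), N.det ≠ 0 ∧ StrictMono J ∧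
      ∀ l, (M * N) (J l) l ≠ 0 ∧ ∀ i, J l < i → (M * N) i l = 0 := by
  classical
  have hinj : Function.Injective M.mulVec := by
    rw [Matrix.mulVec_injective_iff]
    rw [linearIndependent_iff_card_eq_finrank_span, Set.finrank, ← M.rank_eq_finrank_span_cols, hM,
      Fintype.card_fin]
  have hcol : ∀ N : Matrix (Fin r) (Fin r) K, N.det ≠ 0 → ∀ l, (M * N).col l ≠ 0 := by
    intro N hN l h0
    refine hN (Matrix.det_eq_zero_of_column_eq_zero l fun i => ?_)
    have h1 : M.mulVec (N.col l) = M.mulVec 0 := by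
      rw [Matrix.mulVec_zero, ← h0]
      rfl
    exact congrFun (hinj h1) i
  -- Take `N` with the least total of top indices: if two columns shared a pivot row, subtracting a
  -- multiple of one from the other would lower the total.
  have hex : ∃ n, ∃ N : Matrix (Fin r) (Fin r) K, N.det ≠ 0 ∧
      ∑ l, topIndex ((M * N).col l) = n := ⟨_, 1, by simp, rfl⟩
  obtain ⟨N, hN, hNmin⟩ := Nat.find_spec hex
  choose I hI hItop using fun l => exists_topIndex_eq (hcol N hN l)
  have hIinj : Function.Injective I := by
    intro l l' hll
    by_contra hne
    set c : K := -((M * N) (I l) l / (M * N) (I l) l') with hc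
    set N' := N.updateCol l fun i => N i l + c • N i l' with hN'
    have hdet : N'.det ≠ 0 := by rwa [hN', Matrix.det_updateCol_add_smul_self _ hne]
    have hother : ∀ m, m ≠ l → (M * N').col m = (M * N).col m := fun m hm => by
      ext i
      simp [Matrix.mul_apply, hN', Matrix.updateCol_ne hm]
    have hself : ∀ i, (M * N') i l = (M * N) i l + c * (M * N) i l' := fun i => by
      simp only [Matrix.mul_apply, hN', Matrix.updateCol_self, Finset.mul_sum,
        ← Finset.sum_add_distrib, smul_eq_mul]
      exact Finset.sum_congr rfl fun j _ => by ring
    have hlt : topIndex ((M * N').col l) < topIndex ((M * N).col l) := by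
      rw [hItop l, Nat.lt_succ_iff]
      refine topIndex_le fun i hi => ?_
      change (M * N') i l = 0
      rw [hself]
      rcases hi.eq_or_lt with hi | hi
      · have h' := hI l'
        rw [← hll] at h'
        change (M * N) (I l) l' ≠ 0 at h'
        rw [← Fin.ext hi, hc, neg_mul, div_mul_cancel₀ _ h', add_neg_cancel]
      · have h1 : (M * N).col l i = 0 := eq_zero_of_topIndex_le (by rw [hItop]; omega)
        have h2 : (M * N).col l' i = 0 := eq_zero_of_topIndex_le (by rw [hItop, ← hll]; omega)
        change (M * N) i l = 0 at h1
        change (M * N) i l' = 0 at h2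
        rw [h1, h2, mul_zero, add_zero]
    have hsum : ∑ m, topIndex ((M * N').col m) < ∑ m, topIndex ((M * N).col m) := by
      refine Finset.sum_lt_sum (fun m _ => ?_) ⟨l, Finset.mem_univ l, hlt⟩
      by_cases hm : m = l
      · exact hm ▸ hlt.le
      · rw [hother m hm]
    rw [hNmin] at hsum
    exact Nat.find_min hex hsum ⟨N', hdet, rfl⟩
  set σ := Tuple.sort I
  refine ⟨N.submatrix id σ, I ∘ σ, ?_, ?_, fun l => ?_⟩
  · rw [Matrix.det_permute']
    exact mul_ne_zero ((Units.isUnit _).map (Int.castRingHom K)).ne_zero hN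
  · exact (Tuple.monotone_sort I).strictMono_of_injective (hIinj.comp σ.injective)
  · have h : ∀ i, (M * N.submatrix id σ) i l = (M * N) i (σ l) := fun i => rfl
    simp only [h]
    refine ⟨hI _, fun i hi => ?_⟩
    refine eq_zero_of_topIndex_le (w := (M * N).col (σ l)) ?_
    rw [hItop]
    exact hi

end

/-! ### The determinant -/

section

open Matrix in
-- Multilinearity in the columns. The sum runs over all maps `φ`; non-injective ones give a zero
-- determinant and need no separate treatment.
theorem det_mul_eq_sum {R : Type*} [CommRing R] {m n : Type*} [Fintype m] [DecidableEq m]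
    [Fintype n] [DecidableEq n] (E : Matrix m n R) (A : Matrix n m R) :
    (E * A).det = ∑ φ : m → n, (∏ l, A (φ l) l) * (E.submatrix id φ).det := by
  rw [← det_transpose]
  have h : (E * A)ᵀ = fun l => ∑ j, A j l • Eᵀ j := by
    ext l i
    simp [mul_apply, mul_comm]
  have := (detRowAlternating (R := R) (n := m)).toMultilinearMap.map_sum
    (fun l (j : n) => A j l • Eᵀ j)
  rw [h]
  refine this.trans (Finset.sum_congr rfl fun φ _ => ?_)
  rw [MultilinearMap.map_smul_univ, smul_eq_mul, ← det_transpose (E.submatrix id φ)]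
  rfl

theorem det_pow_mul {R : Type*} [CommRing R] {r : ℕ} (θ f : Fin r → R) :
    (Matrix.of fun i j : Fin r => θ j ^ (i : ℕ) * f j).det =
      (∏ j, f j) * ∏ i, ∏ j ∈ Finset.Ioi i, (θ j - θ i) := by
  rw [← Matrix.det_vandermonde, ← Matrix.det_transpose (Matrix.vandermonde θ),
    ← Matrix.det_mul_row]
  congr 1
  ext i j
  simp [Matrix.vandermonde, mul_comm]

theorem addValuation_map_prod {R Γ : Type*} [CommRing R] [LinearOrderedAddCommMonoidWithTop Γ]
    (v : AddValuation R Γ) {ι : Type*} (s : Finset ι) (x : ι → R) :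
    v (∏ i ∈ s, x i) = ∑ i ∈ s, v (x i) := by
  classical
  induction s using Finset.induction_on with
  | empty => simp
  | insert i s hi ih => rw [Finset.prod_insert hi, Finset.sum_insert hi, v.map_mul, ih]

variable {K F : Type*} [Field K] [Field F] [Algebra K F]

/-- The order at `P` of the determinant of a matrix with entries `θ_j ^ i * f_j` multiplied by a
constant matrix in column echelon form. -/
theorem Place.v_det_mul (P : Place K F) {r k : ℕ} {f θ : Fin k → F} {a b : Fin k → ℤ}
    (hf : ∀ j, P.v (f j) = a j) (ha : StrictAnti a)
    (hθ : ∀ i j, i < j → P.v (θ j - θ i) = b j) (hb : Antitone b)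
    (A : Matrix (Fin k) (Fin r) K) {J : Fin r → Fin k} (hJ : StrictMono J)
    (hA : ∀ l, A (J l) l ≠ 0 ∧ ∀ i, J l < i → A i l = 0) :
    P.v ((Matrix.of fun (i : Fin r) j => θ j ^ (i : ℕ) * f j) * A.map (algebraMap K F)).det =
      ((∑ l, a (J l) + ∑ l, ∑ l' ∈ Finset.Ioi l, b (J l') : ℤ) : WithTop ℤ) := by
  classical
  set E : Matrix (Fin r) (Fin k) F := Matrix.of fun (i : Fin r) j => θ j ^ (i : ℕ) * f j
  set T : (Fin r → Fin k) → F :=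
    fun φ => (∏ l, A.map (algebraMap K F) (φ l) l) * (E.submatrix id φ).det with hT
  have hdet : ∀ φ, P.v (E.submatrix id φ).det =
      ((∑ l, a (φ l) : ℤ) : WithTop ℤ) + ∑ l, ∑ l' ∈ Finset.Ioi l, P.v (θ (φ l') - θ (φ l)) := by
    intro φ
    have h1 : E.submatrix id φ =
        Matrix.of fun i j : Fin r => (θ ∘ φ) j ^ (i : ℕ) * (f ∘ φ) j := rfl
    rw [h1, det_pow_mul, P.v.map_mul, addValuation_map_prod, addValuation_map_prod, WithTop.coe_sum]
    congr 1
    · exact Finset.sum_congr rfl fun l _ => hf _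
    · exact Finset.sum_congr rfl fun l _ => addValuation_map_prod _ _ _
  have hconst : ∀ φ : Fin r → Fin k, (∀ l, A (φ l) l ≠ 0) →
      ∑ l, P.v (A.map (algebraMap K F) (φ l) l) = 0 := fun φ hφ =>
    Finset.sum_eq_zero fun l _ => P.trivial_on_constants _ (hφ l)
  have hmain : P.v (T J) =
      ((∑ l, a (J l) + ∑ l, ∑ l' ∈ Finset.Ioi l, b (J l') : ℤ) : WithTop ℤ) := by
    rw [hT, P.v.map_mul, hdet, addValuation_map_prod,
      hconst J fun l => (hA l).1, zero_add, WithTop.coe_add,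
      WithTop.coe_sum _ (fun l => ∑ l' ∈ Finset.Ioi l, b (J l'))]
    congr 1
    refine Finset.sum_congr rfl fun l _ => ?_
    rw [WithTop.coe_sum]
    exact Finset.sum_congr rfl fun l' hl' => hθ _ _ (hJ (Finset.mem_Ioi.1 hl'))
  have hother : ∀ φ, φ ≠ J → P.v (T J) < P.v (T φ) := by
    intro φ hφ
    by_cases hz : ∃ l, A (φ l) l = 0
    · obtain ⟨l, hl⟩ := hz
      have h0 : T φ = 0 := by
        rw [hT]
        refine mul_eq_zero_of_left (Finset.prod_eq_zero (Finset.mem_univ l) ?_) _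
        rw [Matrix.map_apply, hl, map_zero]
      rw [h0, P.v.map_zero, hmain]
      exact WithTop.coe_lt_top _
    push Not at hz
    -- Entries below a pivot vanish, so in a nonzero term each index is at most its pivot. Replacing
    -- pivots by smaller indices strictly raises the sum of the `a` values and does not lower the
    -- Vandermonde part.
    have hle : ∀ l, φ l ≤ J l := fun l => not_lt.1 fun h => hz l ((hA l).2 _ h)
    rw [hmain, hT, P.v.map_mul, hdet, addValuation_map_prod,
      hconst φ hz, zero_add, WithTop.coe_add]
    have hlt : ∑ l, a (J l) < ∑ l, a (φ l) := by
      obtain ⟨l, hl⟩ := Function.ne_iff.1 hφ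
      exact Finset.sum_lt_sum (fun l _ => ha.antitone (hle l))
        ⟨l, Finset.mem_univ l, ha ((hle l).lt_of_ne hl)⟩
    have hge : ((∑ l, ∑ l' ∈ Finset.Ioi l, b (J l') : ℤ) : WithTop ℤ) ≤
        ∑ l, ∑ l' ∈ Finset.Ioi l, P.v (θ (φ l') - θ (φ l)) := by
      rw [WithTop.coe_sum]
      refine Finset.sum_le_sum fun l _ => ?_
      rw [WithTop.coe_sum]
      refine Finset.sum_le_sum fun l' hl' => ?_
      have hll : l < l' := Finset.mem_Ioi.1 hl'
      -- `φ` need not preserve order, but the larger of the two indices is still at most `J l'`;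
      -- equal indices give the value `⊤`.
      rcases lt_trichotomy (φ l) (φ l') with h | h | h
      · rw [hθ _ _ h]
        exact WithTop.coe_le_coe.2 (hb (hle l'))
      · simp [h]
      · rw [P.v.map_sub_swap, hθ _ _ h]
        exact WithTop.coe_le_coe.2 (hb ((hle l).trans (hJ hll).le))
    refine lt_of_lt_of_le ?_ (add_le_add_right hge _)
    rw [← WithTop.coe_add, ← WithTop.coe_add, WithTop.coe_lt_coe]
    linarith
  rw [det_mul_eq_sum, ← hmain, ← Finset.add_sum_erase _ _ (Finset.mem_univ J)]
  refine P.v.map_add_eq_of_lt_left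
    (P.v.map_lt_sum ?_ fun φ hφ => hother φ (Finset.ne_of_mem_erase hφ))
  change P.v (T J) ≠ ⊤
  rw [hmain]
  exact WithTop.coe_ne_top

end

end FunField

/-! ### The pole of det(E M) at P_∞ -/

namespace FunField

section

variable {K F : Type*} [Field K] [Field F] [Algebra K F]

theorem Place.det_mem_O (P : Place K F) {r : ℕ} {A : Matrix (Fin r) (Fin r) F}
    (hA : ∀ i j, A i j ∈ P.O) : A.det ∈ P.O := by
  have h : A.det = P.O.subtype (Matrix.of fun i j => (⟨A i j, hA i j⟩ : P.O)).det := by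
    rw [RingHom.map_det]
    rfl
  rw [h]
  exact Subtype.property _

/-- Both determinants are images of a single one over the valuation ring, under evaluation and
inclusion. -/
theorem RationalPlace.det_evalMatrix_mul_eq_zero_iff (P : RationalPlace K F) {r k : ℕ}
    {E : Matrix (Fin r) (Fin k) F} (hE : ∀ i j, E i j ∈ P.1.O) (M : Matrix (Fin k) (Fin r) K) :
    (evalMatrix P E * M).det = 0 ↔ 0 < P.1.v (E * M.map (algebraMap K F)).det := by
  set E' : Matrix (Fin r) (Fin k) P.1.O := Matrix.of fun i j => ⟨E i j, hE i j⟩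
  set D := (E' * M.map (algebraMap K P.1.O)).det
  have h1 : (E * M.map (algebraMap K F)).det = (D : F) := by
    change _ = P.1.O.subtype D
    rw [RingHom.map_det, RingHom.mapMatrix_apply, Matrix.map_mul]
    rfl
  have h2 : (evalMatrix P E * M).det = P.evalHom D := by
    rw [RingHom.map_det, RingHom.mapMatrix_apply, Matrix.map_mul]
    congr 2
    · ext i j
      exact P.eval_of_mem (hE i j)
    · ext i j
      exact (P.evalHom_algebraMap _).symm
  rw [h1, h2, P.evalHom_eq_zero_iff]

/-- The differences of the nodes `γ ^ β(j) * g_α(j)` have the order of the later node. -/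
theorem Place.v_node_sub [Finite K] (P : Place K F) {k : ℕ} {γ : Kˣ}
    (hγ : ∀ x : Kˣ, x ∈ Subgroup.zpowers γ) {g : Fin (blockCount (Nat.card K) k) → F}
    (hg : StrictAnti fun j => P.v (g j)) {i j : Fin k} (hij : i < j) :
    P.v (algebraMap K F ((γ : K) ^ beta K j) * g (alpha (K := K) j) -
      algebraMap K F ((γ : K) ^ beta K i) * g (alpha (K := K) i)) = P.v (g (alpha (K := K) j)) := by
  have hnode : ∀ i : Fin k, P.v (algebraMap K F ((γ : K) ^ beta K i) * g (alpha (K := K) i)) =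
      P.v (g (alpha (K := K) i)) := fun i => by
    rw [P.v.map_mul, P.trivial_on_constants _ (pow_ne_zero _ γ.ne_zero), zero_add]
  have hle : alpha (K := K) i ≤ alpha (K := K) j := Nat.div_le_div_right hij.le
  -- In different blocks the later node has strictly smaller value. In the same block the exponents
  -- are distinct residues modulo the order of `γ`, so the difference is a nonzero constant times
  -- `g`.
  rcases hle.lt_or_eq with h | h
  · rw [P.v.map_sub_eq_of_lt_left, hnode]
    rw [hnode, hnode]
    exact hg h
  · have hord : orderOf γ = Nat.card K - 1 := by
      rw [orderOf_eq_card_of_forall_mem_zpowers hγ, Nat.card_units]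
    have hpos : 0 < Nat.card K - 1 := Nat.sub_pos_of_lt Finite.one_lt_card
    have hne : (γ : K) ^ beta K j - (γ : K) ^ beta K i ≠ 0 := by
      intro h0
      have h1 : γ ^ beta K j = γ ^ beta K i := Units.ext (by simpa using sub_eq_zero.1 h0)
      have h2 := pow_injOn_Iio_orderOf (x := γ) (by rw [hord]; exact Nat.mod_lt _ hpos)
        (by rw [hord]; exact Nat.mod_lt _ hpos) h1
      have h3 : (i : ℕ) / (Nat.card K - 1) = j / (Nat.card K - 1) := congrArg Fin.val h
      have h4 := Nat.div_add_mod (i : ℕ) (Nat.card K - 1)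
      have h5 := Nat.div_add_mod (j : ℕ) (Nat.card K - 1)
      have h6 : (j : ℕ) % (Nat.card K - 1) = i % (Nat.card K - 1) := h2
      rw [h3, ← h6, h5] at h4
      exact hij.ne' (Fin.ext h4)
    rw [h, ← sub_mul, ← map_sub, P.v.map_mul, P.trivial_on_constants _ hne, zero_add]

/-- The orders of a family as in `HasDecreasingOrders`. -/
theorem HasDecreasingOrders.exists_orders {P : Place K F} {d : ℤ} {n : ℕ} {f : Fin n → F}
    (hf : HasDecreasingOrders P d f) :
    ∃ a : Fin n → ℤ, (∀ j, P.v (f j) = a j) ∧ StrictAnti a ∧ (∀ j, a j ≤ 0) ∧ ∀ j, -d ≤ a j := by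
  choose a ha using fun j => WithTop.ne_top_iff_exists.1
    ((hf.nonpos j).trans_lt (WithTop.coe_lt_top (0 : ℤ))).ne
  refine ⟨a, fun j => (ha j).symm, fun i j hij => ?_, fun j => ?_, fun j => ?_⟩
  · have := hf.strictAnti hij
    simp only [← ha] at this
    exact WithTop.coe_lt_coe.1 this
  · have := hf.nonpos j
    rw [← ha] at this
    exact_mod_cast this
  · have := hf.ge j
    rw [← ha] at this
    exact WithTop.coe_le_coe.1 this

/-- Integer values drop by at least one at each of the `r - 1 - l` steps after `l`. -/
theorem add_le_of_strictAnti {r : ℕ} {u : Fin r → ℤ} (hu : StrictAnti u) {m : ℤ}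
    (hm : ∀ l, m ≤ u l) (l : Fin r) : m + ((r : ℤ) - 1 - l) ≤ u l := by
  have key : ∀ (i : ℕ) (l : Fin r), (l : ℕ) + i + 1 = r → m + i ≤ u l := by
    intro i
    induction i with
    | zero => simpa using fun l _ => hm l
    | succ i ih =>
      intro l hl
      have h1 := ih ⟨l + 1, by omega⟩ (by simp only; omega)
      have h2 : u ⟨l + 1, by omega⟩ < u l := hu (Fin.lt_def.2 (Nat.lt_succ_self _))
      push_cast
      omega
  have := key (r - 1 - l) l (by omega)
  omega

theorem two_mul_sum_fin_sub (r : ℕ) : 2 * ∑ l : Fin r, ((r : ℤ) - 1 - l) = r * (r - 1) := by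
  induction r with
  | zero => simp
  | succ r ih =>
    rw [Fin.sum_univ_succ]
    have h : ∀ l : Fin r, ((r + 1 : ℕ) : ℤ) - 1 - (l.succ : ℕ) = r - 1 - l := fun l => by
      push_cast [Fin.val_succ]
      ring
    simp only [h, mul_add, ih]
    push_cast
    simp
    ring

/-- The determinant of `E M` has a pole of bounded order at `P`; in particular it is nonzero. -/
theorem exists_v_det_fsMatrix_mul [Finite K] {r k : ℕ} (P : Place K F) {γ : Kˣ}
    (hγ : ∀ x : Kˣ, x ∈ Subgroup.zpowers γ) {f : Fin k → F}
    {g : Fin (blockCount (Nat.card K) k) → F} {d₁ d₂ : ℤ} (hf : HasDecreasingOrders P d₁ f)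
    (hg : HasDecreasingOrders P d₂ g) (M : Matrix (Fin k) (Fin r) K) (hM : M.rank = r) :
    ∃ n : ℕ, P.v (fsMatrix r k γ f g * M.map (algebraMap K F)).det = ((-n : ℤ) : WithTop ℤ) ∧
      2 * (n : ℤ) ≤ 2 * r * d₁ + r * (r - 1) * (d₂ - 1) := by
  obtain ⟨N, J, hN, hJ, hA⟩ := exists_echelon M hM
  obtain ⟨a, ha, ha_anti, ha0, had⟩ := hf.exists_orders
  obtain ⟨b, hb, hb_anti, hb0, hbd⟩ := hg.exists_orders
  have h : P.v (fsMatrix r k γ f g * (M * N).map (algebraMap K F)).det =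
      ((∑ l, a (J l) + ∑ l, ∑ l' ∈ Finset.Ioi l, b (alpha (K := K) (J l')) : ℤ) : WithTop ℤ) :=
    P.v_det_mul (b := fun j => b (alpha (K := K) j)) ha ha_anti
    (fun i j hij => (P.v_node_sub hγ hg.strictAnti hij).trans (hb _))
    (fun i j hij => hb_anti.antitone (show alpha (K := K) i ≤ alpha (K := K) j from
      Nat.div_le_div_right hij)) (M * N) hJ hA
  -- Passing to echelon form multiplies the determinant by a nonzero constant, of value 0.
  rw [Matrix.map_mul, ← Matrix.mul_assoc, Matrix.det_mul, P.v.map_mul] at h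
  have hdetN : (N.map (algebraMap K F)).det = algebraMap K F N.det :=
    (RingHom.map_det (algebraMap K F) N).symm
  rw [hdetN, P.trivial_on_constants _ hN, add_zero] at h
  set s := ∑ l, a (J l) + ∑ l, ∑ l' ∈ Finset.Ioi l, b (alpha (K := K) (J l')) with hs
  have hs0 : s ≤ 0 := add_nonpos (Finset.sum_nonpos fun l _ => ha0 _)
    (Finset.sum_nonpos fun l _ => Finset.sum_nonpos fun l' _ => hb0 _)
  have hs1 : ∑ l : Fin r, (-d₁ + ((r : ℤ) - 1 - l)) ≤ ∑ l, a (J l) :=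
    Finset.sum_le_sum fun l _ => add_le_of_strictAnti (u := a ∘ J)
      (fun i j hij => ha_anti (hJ hij)) (fun l => had _) l
  have hs2 : ∑ l : Fin r, ((r : ℤ) - 1 - l) * (-d₂) ≤
      ∑ l, ∑ l' ∈ Finset.Ioi l, b (alpha (K := K) (J l')) := by
    refine Finset.sum_le_sum fun l _ => ?_
    have h1 := Finset.card_nsmul_le_sum (Finset.Ioi l) (fun l' => b (alpha (K := K) (J l'))) (-d₂)
      (fun l' _ => hbd _)
    rw [Fin.card_Ioi, nsmul_eq_mul] at h1
    have h2 : ((r - 1 - l : ℕ) : ℤ) = (r : ℤ) - 1 - l := by omega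
    rwa [h2] at h1
  have hsum := two_mul_sum_fin_sub r
  rw [Finset.sum_add_distrib, Finset.sum_const, Finset.card_univ, Fintype.card_fin,
    nsmul_eq_mul] at hs1
  rw [← Finset.sum_mul] at hs2
  refine ⟨s.natAbs, ?_, ?_⟩
  · rw [h]
    congr 1
    omega
  · have h3 : ((s.natAbs : ℕ) : ℤ) = -s := by omega
    rw [h3]
    have h4 : r * (-d₁) + ∑ l : Fin r, ((r : ℤ) - 1 - l) +
      (∑ l : Fin r, ((r : ℤ) - 1 - l)) * (-d₂) ≤ s := add_le_add hs1 hs2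
    have h5 : (∑ l : Fin r, ((r : ℤ) - 1 - l)) * d₂ * 2 = r * (r - 1) * d₂ := by
      rw [← hsum]
      ring
    linarith

end

end FunField

/-! ### Conclusion -/

theorem theorem4p3 {K F : Type*} [Field K] [Finite K] [Field F] [Algebra K F]
    (hF : FunField.IsFunctionField K F) (r k : ℕ) (hr : 1 ≤ r) (hrk : r ≤ k)
    (Pinf : FunField.RationalPlace K F) (γ : Kˣ) (hγ : ∀ x : Kˣ, x ∈ Subgroup.zpowers γ)
    (f : Fin k → F) (g : Fin (FunField.blockCount (Nat.card K) k) → F)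
    (hf : FunField.HasDecreasingOrders Pinf.1 ((k : ℤ) - 1 + FunField.genus K F) f)
    (hg : FunField.HasDecreasingOrders Pinf.1
      ((FunField.blockCount (Nat.card K) k : ℤ) - 1 + FunField.genus K F) g)
    (M : Matrix (Fin k) (Fin r) K) (hM : M.rank = r) :
    {P : FunField.RationalPlace K F | P ≠ Pinf ∧
        (FunField.evalMatrix P (FunField.fsMatrix r k γ f g) * M).rank ≠ r}.Finite ∧
      (({P : FunField.RationalPlace K F | P ≠ Pinf ∧
        (FunField.evalMatrix P (FunField.fsMatrix r k γ f g) * M).rank ≠ r}.ncard : ℕ) : ℚ) ≤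
        (r : ℚ) * ((k : ℚ) - r + ((r : ℚ) - 1) / 2 * (⌈(k : ℚ) / ((Nat.card K : ℚ) - 1)⌉ : ℤ) +
          ((r : ℚ) + 1) / 2 * FunField.genus K F) := by
  classical
  obtain ⟨n, hn, hnle⟩ := FunField.exists_v_det_fsMatrix_mul Pinf.1 hγ hf hg M hM
  set D := (FunField.fsMatrix r k γ f g * M.map (algebraMap K F)).det with hD
  set B := {P : FunField.RationalPlace K F | P ≠ Pinf ∧
    (FunField.evalMatrix P (FunField.fsMatrix r k γ f g) * M).rank ≠ r} with hB
  have hD0 : D ≠ 0 := by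
    intro h
    rw [h, AddValuation.map_zero] at hn
    exact WithTop.top_ne_coe hn
  -- The natural-number ceiling agrees with the integer one because the quotient is nonnegative.
  have hneg : ((FunField.blockCount (Nat.card K) k : ℤ) : ℚ) =
      (⌈(k : ℚ) / ((Nat.card K : ℚ) - 1)⌉ : ℤ) := by
    have hq : (1 : ℚ) < Nat.card K := by exact_mod_cast Finite.one_lt_card (α := K)
    rw [FunField.blockCount, Int.natCast_ceil_eq_ceil (div_nonneg (by positivity) (by linarith))]
  have hcard : ∀ s : Finset (FunField.RationalPlace K F), ↑s ⊆ B → s.card ≤ n := by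
    intro s hs
    let ι : FunField.RationalPlace K F ↪ FunField.Place K F := ⟨Subtype.val, Subtype.val_injective⟩
    rw [← Finset.card_map ι]
    refine hF.card_zeros_le Pinf hD0 (fun P hP => ?_) hn.ge _ fun P hP => ?_
    · refine P.det_mem_O fun i j => ?_
      rw [Matrix.mul_apply]
      exact Subring.sum_mem P.O.toSubring fun l _ => mul_mem
        (FunField.fsMatrix_mem_O γ hP hf hg i l) (P.v_algebraMap_nonneg _)
    · obtain ⟨P, hPs, rfl⟩ := Finset.mem_map.1 hP
      obtain ⟨hP1, hP2⟩ := hs hPs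
      refine (P.det_evalMatrix_mul_eq_zero_iff (fun i j => FunField.fsMatrix_mem_O γ
        (fun h => hP1 (Subtype.ext h)) hf hg i j) M).1 ?_
      by_contra h0
      exact hP2 ((Matrix.rank_of_det_ne_zero h0).trans (Fintype.card_fin r))
  -- The bound on finite subsets gives finiteness too, so `ncard` is not the default value 0 of an
  -- infinite set.
  have hfin : B.Finite := by
    by_contra hinf
    obtain ⟨s, hs, hsc⟩ := Set.Infinite.exists_subset_card_eq hinf (n + 1)
    have := hcard s hs
    omega
  refine ⟨hfin, ?_⟩
  have h1 : B.ncard ≤ n := by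
    rw [Set.ncard_eq_toFinset_card B hfin]
    exact hcard _ (by simp)
  have h2 : (B.ncard : ℚ) ≤ n := by exact_mod_cast h1
  have h3 : (2 * n : ℚ) ≤ 2 * r * ((k : ℚ) - 1 + FunField.genus K F) + r * (r - 1) *
      ((FunField.blockCount (Nat.card K) k : ℤ) - 1 + FunField.genus K F - 1) := by
    exact_mod_cast hnle
  rw [hneg] at h3
  refine h2.trans ?_
  linarith
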